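/- Let $\mathbb{K}\in\{\mathbb{R},\mathbb{C}\}$ and let $M$ be a unital Jordan-Banach algebra over $\mathbb{K}$: a (not necessarily associative) commutative $\mathbb{K}$-algebra with product $\circ$ and unit $\mathbf{1}$ satisfying the Jordan identity $(a\circ b)\circ a^2=a\circ(b\circ a^2)$, equipped with a complete norm such that $\|a\circ b\|\le\|a\|\,\|b\|$ for all $a,b\in M$ and $\|\mathbf{1}\|=1$. For $a,b\in M$ put $U_a(b)=2(a\circ b)\circ a-a^2\circ b$. Define powers by $a^0=\mathbf{1}$, $a^{n+1}=a\circ a^n$ $(n\ge 0)$, and put $\exp(a)=\sum_{n=0}^\infty \frac{a^n}{n!}$. An element $a\in M$ is invertible if there is a (necessarily unique) $b=a^{-1}\in M$ with $a\circ b=\mathbf{1}$ and $a^2\circ b=a$; let $M^{-1}$ denote the set of invertible elements of $M$, put $a^{-n}=(a^{-1})^n$ for $a\in M^{-1}$ and $n>0$, and let the principal component $M^{-1}_{\mathbf{1}}$ be the connected component of $\mathbf{1}$ in $M^{-1}$. A set $\mathfrak{M}\subseteq M^{-1}$ is called a quadratic subset of $M^{-1}$ if $U_a(b)\in\mathfrak{M}$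 for all $a,b\in\mathfrak{M}$. Then $M^{-1}_{\mathbf{1}}$ is the least quadratic subset of $M^{-1}$ containing $\exp(M)$; that is, $M^{-1}_{\mathbf{1}}$ is a quadratic subset of $M^{-1}$, it contains $\exp(M)$, and it is contained in every quadratic subset of $M^{-1}$ that contains $\exp(M)$. Consequently, $a^n\in M^{-1}_{\mathbf{1}}$ for every $a\in M^{-1}_{\mathbf{1}}$ and every integer $n$. -/

import Mathlib

/-- A (not necessarily associative) commutative unital ring with a submultiplicative norm;
the product plays the role of the Jordan product `a ∘ b`. -/
class NormedNonAssocCommRing (M : Type*) extends NormedAddCommGroup M, NonAssocCommRing M where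
  norm_mul_le' : ∀ a b : M, ‖a * b‖ ≤ ‖a‖ * ‖b‖

/-- A unital Jordan-Banach algebra over `𝕜 = ℝ` or `ℂ`: a commutative, bilinear, unital product
satisfying the Jordan identity `(a ∘ b) ∘ a² = a ∘ (b ∘ a²)` (Mathlib's `IsCommJordan`), together
with a complete norm such that `‖a ∘ b‖ ≤ ‖a‖ ‖b‖` and `‖1‖ = 1`. -/
class UnitalJordanBanachAlgebra (𝕜 M : Type*) [RCLike 𝕜] [NormedNonAssocCommRing M]
    [NormedSpace 𝕜 M] : Prop extends
    IsCommJordan M, IsScalarTower 𝕜 M M, SMulCommClass 𝕜 M M, NormOneClass M, CompleteSpace M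

namespace JordanBanach

section Algebra

variable {M : Type*} [NormedNonAssocCommRing M]

/-- The operator `U_a (x) = 2 (a ∘ x) ∘ a - a² ∘ x`. -/
def U (a x : M) : M := 2 • ((a * x) * a) - (a * a) * x

/-- Powers with natural exponents: `a⁰ = 1`, `aⁿ⁺¹ = a ∘ aⁿ`. -/
def npow (a : M) : ℕ → M
  | 0 => 1
  | n + 1 => a * npow a n

/-- `b` is a Jordan inverse of `a`: `a ∘ b = 1` and `a² ∘ b = a`. -/
def IsInverse (a b : M) : Prop := a * b = 1 ∧ (a * a) * b = a

variable (M) in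
/-- The set `M⁻¹` of invertible elements of `M`. -/
def invertibles : Set M := {a | ∃ b, IsInverse a b}

open Classical in
/-- The Jordan inverse `a⁻¹` of an invertible element (Jordan inverses are unique);
the value at a non-invertible element is `0`. -/
noncomputable def inverse (a : M) : M := if h : ∃ b, IsInverse a b then h.choose else 0

/-- Powers with integer exponents: for `n > 0`, `a⁻ⁿ = (a⁻¹)ⁿ`. -/
noncomputable def zpow (a : M) : ℤ → M
  | Int.ofNat n => npow a n
  | Int.negSucc n => npow (inverse a) (n + 1)

variable (M) in
/-- The principal component of `M⁻¹`: the connected component of `1` in `M⁻¹`. -/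
def principalComponent : Set M := connectedComponentIn (invertibles M) 1

/-- A quadratic subset of `M⁻¹`: a set `S ⊆ M⁻¹` with `U_a (b) ∈ S` for all `a, b ∈ S`. -/
def IsQuadraticSubset (S : Set M) : Prop :=
  S ⊆ invertibles M ∧ ∀ a ∈ S, ∀ b ∈ S, U a b ∈ S

theorem one_mem_invertibles : (1 : M) ∈ invertibles M :=
  ⟨1, by simp [IsInverse]⟩

theorem inverse_spec {a : M} (ha : a ∈ invertibles M) : IsInverse a (inverse a) := by
  have h : ∃ b, IsInverse a b := ha
  rw [inverse, dif_pos h]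
  exact h.choose_spec

end Algebra

section Exp

variable (𝕜 : Type*) {M : Type*} [RCLike 𝕜] [NormedNonAssocCommRing M] [NormedSpace 𝕜 M]

/-- The exponential `exp(a) = ∑ aⁿ / n!`; the series always converges in a unital
Jordan-Banach algebra, see `hasSum_exp`. -/
noncomputable def exp (a : M) : M := ∑' n : ℕ, ((n.factorial : 𝕜)⁻¹) • npow a n

theorem norm_npow_le [UnitalJordanBanachAlgebra 𝕜 M] (a : M) (n : ℕ) :
    ‖npow a n‖ ≤ ‖a‖ ^ n := by
  have h1 : NormOneClass M := UnitalJordanBanachAlgebra.toNormOneClass 𝕜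
  induction n with
  | zero => simp [npow]
  | succ n ih =>
    calc ‖a * npow a n‖ ≤ ‖a‖ * ‖npow a n‖ := NormedNonAssocCommRing.norm_mul_le' _ _
      _ ≤ ‖a‖ * ‖a‖ ^ n := by gcongr
      _ = ‖a‖ ^ (n + 1) := by ring

theorem hasSum_exp [UnitalJordanBanachAlgebra 𝕜 M] (a : M) :
    HasSum (fun n : ℕ => ((n.factorial : 𝕜)⁻¹) • npow a n) (exp 𝕜 a) := by
  have h1 : CompleteSpace M := UnitalJordanBanachAlgebra.toCompleteSpace 𝕜
  refine Summable.hasSum (Summable.of_norm_bounded (Real.summable_pow_div_factorial ‖a‖) ?_)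
  intro n
  rw [norm_smul, norm_inv, RCLike.norm_natCast, div_eq_inv_mul]
  gcongr
  exact norm_npow_le 𝕜 a n

end Exp

end JordanBanach

/-! Let G be the group generated by the operators e^{L_a}, where L_a is multiplication by a. The
principal component turns out to be the orbit G·1 (`expOrbit`), and everything else is read off from
this.

Algebra: U_{e^{L_a} b} = e^{L_a} U_b e^{L_a} (`Uop_exp_apply`), so each g in G has a partner h in G
with U_{gb} = g U_b h. Hence U_{g1} = gh lies in G: the orbit is quadratic, and the inverse of g1 is
h⁻¹1. Since e^{L_a} = U_{exp(a/2)}, every quadratic set containing exp(M) contains the orbit.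

Topology: the paths e^{tL_a}s keep the orbit inside the component. Conversely, the orbit contains
the ball about each of its points p whose radius depends only on ‖p⁻¹‖ (`mem_expOrbit_of_norm_le`).
Inversion is continuous, so this radius is locally bounded below on M⁻¹, and the orbit is both open
and closed there. -/

namespace JordanBanach

/-! ### The Jordan triple product. -/

section Triple

variable {M : Type*} [NormedNonAssocCommRing M]

/-- The polarisation of `a ↦ U_a`. -/
noncomputable def Utri (a d b : M) : M := a * (b * d) + b * (a * d) - (a * b) * d

theorem norm_Utri_le (a d b : M) : ‖Utri a d b‖ ≤ 3 * ‖a‖ * ‖d‖ * ‖b‖ := by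
  have h := @NormedNonAssocCommRing.norm_mul_le' M _
  have h1 : ‖a * (b * d)‖ ≤ ‖a‖ * (‖b‖ * ‖d‖) := (h _ _).trans (by gcongr; exact h _ _)
  have h2 : ‖b * (a * d)‖ ≤ ‖b‖ * (‖a‖ * ‖d‖) := (h _ _).trans (by gcongr; exact h _ _)
  have h3 : ‖(a * b) * d‖ ≤ (‖a‖ * ‖b‖) * ‖d‖ := (h _ _).trans (by gcongr; exact h _ _)
  calc ‖Utri a d b‖ ≤ ‖a * (b * d)‖ + ‖b * (a * d)‖ + ‖(a * b) * d‖ :=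
        (norm_sub_le _ _).trans (by gcongr; exact norm_add_le _ _)
    _ ≤ 3 * ‖a‖ * ‖d‖ * ‖b‖ := by linarith

end Triple

/-! ### The linearised Jordan identity. -/

section Linearization

variable {M : Type*} [NormedNonAssocCommRing M] [NormedSpace ℝ M] [IsCommJordan M]

theorem jordan_linearized (a b c x : M) :
    (a * b) * (c * x) + (b * c) * (a * x) + (c * a) * (b * x) =
      c * ((a * b) * x) + a * ((b * c) * x) + b * ((c * a) * x) := by
  have h : 2 • ((a * ((b * c) * x) - (b * c) * (a * x)) + (b * ((c * a) * x) - (c * a) * (b * x)) +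
      (c * ((a * b) * x) - (a * b) * (c * x))) = 0 :=
    congrArg (fun f : AddMonoid.End M => f x) (two_nsmul_lie_lmul_lmul_add_add_eq_zero a b c)
  have h2 : (2 : ℝ) • ((a * b) * (c * x) + (b * c) * (a * x) + (c * a) * (b * x)) = (2 : ℝ) •
      (c * ((a * b) * x) + a * ((b * c) * x) + b * ((c * a) * x)) := by
    rw [← sub_eq_zero, ← smul_sub, two_smul, ← neg_eq_zero, ← h, two_nsmul]
    abel
  exact smul_right_injective M (two_ne_zero' ℝ) h2

end Linearization

/-! ### Identities between multiplication operators and U-operators. -/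

section Operators

variable {M : Type*} [NormedNonAssocCommRing M] [NormedSpace ℝ M] [IsScalarTower ℝ M M]
  [SMulCommClass ℝ M M]

/-- The multiplication operator `L_a`, as a continuous bilinear map. -/
noncomputable def mulL : M →L[ℝ] M →L[ℝ] M :=
  LinearMap.mkContinuous₂ (LinearMap.mul ℝ M) 1 fun a b => by
    simpa using NormedNonAssocCommRing.norm_mul_le' a b

@[simp] theorem mulL_apply (a b : M) : mulL a b = a * b := rfl

theorem mulL_one : mulL (1 : M) = 1 := by ext x; simp

/-- The operator `U_a` as a continuous linear map. -/
noncomputable def Uop (a : M) : M →L[ℝ] M := 2 • (mulL a * mulL a) - mulL (a * a)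

theorem Uop_apply (a x : M) : Uop a x = U a x := by
  simp only [Uop, U, sub_apply, smul_apply, mul_apply_eq_comp, mulL_apply]
  rw [mul_comm (a * x) a]

theorem Uop_one : Uop (1 : M) = 1 := by
  ext x; simp [Uop_apply, U, two_mul]

theorem Uop_apply_one (a : M) : Uop a 1 = a * a := by
  simp [Uop_apply, U, two_mul]

theorem continuous_Uop : Continuous (Uop : M → M →L[ℝ] M) := by
  have h : Continuous fun a : M => a * a := by
    have : Continuous fun a : M => mulL a a := by fun_prop
    simpa using this
  unfold Uop
  fun_prop

theorem Uop_add_apply (a b d : M) : Uop (a + b) d = Uop a d + Uop b d + 2 • Utri a d b := by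
  simp only [Uop_apply, U, Utri, add_mul, mul_add, mul_comm b a, mul_comm (_ * d)]
  abel

variable [IsCommJordan M]

theorem mulL_lie_cyclic (a b c : M) :
    mulL (a * b) * mulL c + mulL (b * c) * mulL a + mulL (c * a) * mulL b =
      mulL c * mulL (a * b) + mulL a * mulL (b * c) + mulL b * mulL (c * a) := by
  ext x
  exact jordan_linearized a b c x

/-- The left side of `jordan_linearized` is symmetric under exchanging c and x, so the right sides
for both orders agree. -/
theorem mulL_mul_mul (a b c : M) :
    mulL ((a * b) * c) = mulL c * mulL (a * b) + mulL a * mulL (b * c) + mulL b * mulL (c * a)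
      - mulL a * mulL c * mulL b - mulL b * mulL c * mulL a := by
  ext x
  have h1 := jordan_linearized a b c x
  have h2 := jordan_linearized a b x c
  simp only [sub_apply, add_apply, mul_apply_eq_comp, mulL_apply]
  have e1 : x * (a * b * c) = a * b * c * x := mul_comm _ _
  have e2 : a * (b * x * c) = a * (c * (b * x)) := by rw [mul_comm c]
  have e3 : b * (x * a * c) = b * (c * (a * x)) := by rw [mul_comm c, mul_comm x a]
  have e4 : a * b * (x * c) = a * b * (c * x) := by rw [mul_comm c]
  have e5 : b * x * (a * c) = c * a * (b * x) := by rw [mul_comm c, mul_comm (b * x)]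
  have e6 : x * a * (b * c) = b * c * (a * x) := by rw [mul_comm x, mul_comm (a * x)]
  rw [e1, e2, e3, e4, e5, e6] at h2
  rw [← h1]
  have h3 : a * b * (c * x) + b * c * (a * x) + c * a * (b * x) =
    a * b * (c * x) + c * a * (b * x) + b * c * (a * x) := by abel
  rw [h3, h2]
  abel

theorem commute_mulL_sq (a : M) : Commute (mulL a) (mulL (a * a)) := by
  ext x
  have h := IsCommJordan.lmul_comm_rmul_rmul a x
  simp only [mul_apply_eq_comp, mulL_apply]
  rw [mul_comm (a * a) x, ← h, mul_comm]

/-- The right side is the derivative of b ↦ U_b in direction a ∘ b; this is the infinitesimal form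
of `Uop_exp_apply`. -/
theorem mulL_mul_Uop_add (a b : M) :
    mulL a * Uop b + Uop b * mulL a =
      2 • (mulL (a * b) * mulL b + mulL b * mulL (a * b)) - 2 • mulL ((a * b) * b) := by
  have h1 := mulL_lie_cyclic a b b
  have h2 := mulL_mul_mul a b b
  rw [mul_comm b a] at h1 h2
  simp only [Uop]
  linear_combination (norm := noncomm_ring) 2 • h2 - h1

end Operators

/-! ### Jordan inverses and invertibility of U-operators. -/

section Inverse

variable {M : Type*} [NormedNonAssocCommRing M] [NormedSpace ℝ M] [IsScalarTower ℝ M M]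
  [SMulCommClass ℝ M M]

theorem IsInverse.Uop_apply {c b : M} (h : IsInverse c b) : Uop c b = c := by
  rw [JordanBanach.Uop_apply, U, h.1, h.2, one_mul, two_smul, add_sub_cancel_right]

variable [IsCommJordan M]

set_option maxHeartbeats 2000000 in
/-- A Jordan inverse operator-commutes with the element it inverts, and is inverted by it; the
corresponding `U`-operators are mutually inverse. -/
theorem IsInverse.Uop_mul_Uop {c b : M} (h : IsInverse c b) :
    Uop c * Uop b = 1 ∧ Uop b * Uop c = 1 := by
  obtain ⟨hcb, hccb⟩ := h
  have tf : ∀ T : M →L[ℝ] M, T + T = 0 → T = 0 := fun T hT => by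
    have : (2 : ℝ) • T = 0 := by rw [two_smul, hT]
    simpa using this
  have hbc : b * c = 1 := by rw [mul_comm, hcb]
  have hbcc : b * (c * c) = c := by rw [mul_comm, hccb]
  have a1 := mulL_lie_cyclic c c b
  have a2 := mulL_lie_cyclic c b b
  have a3 := mulL_lie_cyclic (c * c) b b
  have a4 := mulL_mul_mul c c b
  have a5 := mulL_mul_mul c b c
  have h1 := (commute_mulL_sq c).eq
  have h2 := (commute_mulL_sq b).eq
  rw [hcb, hbc, mulL_one] at a1 a2 a4
  rw [hccb, hbcc] at a3
  rw [hccb] at a4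
  rw [hcb, hbc, one_mul, mulL_one] at a5
  have h3 : mulL (c * c) * mulL b = mulL b * mulL (c * c) := by
    linear_combination (norm := noncomm_ring) a1
  have h4 : mulL (b * b) * mulL c = mulL c * mulL (b * b) := by
    linear_combination (norm := noncomm_ring) a2
  have h5 : mulL c + mulL (c * c) * mulL b = 2 • (mulL c * mulL b * mulL c) := by
    linear_combination (norm := noncomm_ring) h3 - a4
  have h6 : mulL c + mulL (c * c) * mulL b
      = mulL c * mulL c * mulL b + mulL b * mulL c * mulL c := by
    linear_combination (norm := noncomm_ring) h3 - a5
  have s1 : (c * c) * (b * b) = 1 := by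
    have := congrArg (fun T : M →L[ℝ] M => T b) h5
    simp [hcb, two_smul] at this
    exact this
  have s2 : c * (c * (b * b)) = 1 := by
    have := congrArg (fun T : M →L[ℝ] M => T b) h6
    simp [hcb, hbc, s1] at this
    exact this.symm
  have a6 := mulL_mul_mul b b (c * c)
  rw [mul_comm (b * b), s1, hbcc, hccb, mulL_one] at a6
  have s3 : (c * c) * (c * (b * b)) = c := by
    have := congrArg (fun T : M →L[ℝ] M => T (b * b)) h1
    simp [s1] at this
    exact this.symm
  generalize hA : mulL c = A at *
  generalize hB : mulL b = B at *
  generalize hP : mulL (c * c) = P at *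
  generalize hS : mulL (b * b) = S at *
  have h7 : 2 • (A * B - B * A) = P * S - S * P := by
    linear_combination (norm := noncomm_ring) a3
  have h8 : 1 = 2 • (B * A) + P * S - 2 • (P * B * B) := by
    linear_combination (norm := noncomm_ring) a6 + 2 • (h3 * B)
  have h8' : 1 = 2 • (A * B) + S * P - 2 • (P * B * B) := by
    linear_combination (norm := noncomm_ring) h8 - h7
  -- The commutator D vanishes: once B D, A D and P D are known to be zero, multiplying `h8'` by D
  -- on the right leaves D = 0.
  obtain ⟨D, hD⟩ : ∃ D, D = A * B - B * A := ⟨_, rfl⟩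
  have hDB : D * B = 0 := tf _ <| by
    rw [hD]
    linear_combination (norm := noncomm_ring)
      B * h8' - h8' * B + h2 * P - S * h3 + 2 • (h3 * B * B)
  have hBD : B * D = 0 := tf _ <| by
    rw [hD]
    linear_combination (norm := noncomm_ring)
      B * h8 - h8 * B + P * h2 - h3 * S + 2 • (h3 * B * B)
  have hAD : A * D = D * A := by
    rw [hD]
    linear_combination (norm := noncomm_ring) h5 - h6
  have hPD : P * D = D * P := by
    rw [hD]
    linear_combination (norm := noncomm_ring) A * h3 - h1 * B + B * h1 - h3 * A
  have hUB : (2 • (A * A) - P) * B = A + 2 • (A * D) := by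
    rw [hD]
    linear_combination (norm := noncomm_ring) -h5
  have hBU : B * (2 • (A * A) - P) = A - 2 • (D * A) := by
    rw [hD]
    linear_combination (norm := noncomm_ring) -h5 + h3
  have e1 : D * A + 2 • (D * A * D) = 0 := by
    linear_combination (norm := noncomm_ring) -(D * hUB) - 2 • (hAD * A * B + A * hAD * B) +
      hPD * B + (2 • (A * A) - P) * hDB
  have e2 : A * D - 2 • (D * A * D) = 0 := by
    linear_combination (norm := noncomm_ring) -(hBU * D) + 2 • (B * (A * hAD + hAD * A)) -
      B * hPD + hBD * (2 • (A * A) - P)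
  have hAD0 : A * D = 0 := tf _ <| by
    linear_combination (norm := noncomm_ring) e1 + e2 + hAD
  rw [hAD0, smul_zero, add_zero] at hUB
  have hUD : (2 • (A * A) - P) * D = 0 := by
    rw [hD]
    linear_combination (norm := noncomm_ring) h1 * B + A * hUB - hUB * A
  have hPD0 : P * D = 0 := by
    linear_combination (norm := noncomm_ring) 2 • (A * hAD0) - hUD
  have hD0 : D = 0 := by
    linear_combination (norm := noncomm_ring)
      h8' * D + 2 • (A * hBD) + S * hPD0 - 2 • (P * B * hBD)
  have hAB : A * B = B * A := by rw [← sub_eq_zero, ← hD, hD0]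
  have hPS : P * S = S * P := by
    linear_combination (norm := noncomm_ring) 2 • hAB - h7
  -- The defect z is killed by A and P, while the identity is a sum of terms ending in A or P.
  have hz : c * (b * b) = b := by
    rw [← sub_eq_zero]
    generalize hz : c * (b * b) - b = z
    have hAz : A z = 0 := by rw [← hA, ← hz, mulL_apply, mul_sub, s2, hcb, sub_self]
    have hPz : P z = 0 := by rw [← hP, ← hz, mulL_apply, mul_sub, s3, hccb, sub_self]
    have e : 1 = 2 • (B * A) + S * P - 2 • (B * B * P) := by
      linear_combination (norm := noncomm_ring) h8' + 2 • hAB - 2 • (h3 * B + B * h3)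
    have := congrArg (fun T : M →L[ℝ] M => T z) e
    simpa [hAz, hPz] using this
  have a7 := mulL_mul_mul b b c
  rw [mul_comm (b * b), hz, hbc, hcb, mulL_one, hA, hB, hS] at a7
  have h9 : A * (2 • (B * B) - S) = B := by
    linear_combination (norm := noncomm_ring) a7 + 2 • (hAB * B)
  have hUV : (2 • (A * A) - P) * (2 • (B * B) - S) = 1 := by
    linear_combination (norm := noncomm_ring) 2 • (A * h9) - h8 + 2 • hAB
  have hcomm : (2 • (B * B) - S) * (2 • (A * A) - P) =
      (2 • (A * A) - P) * (2 • (B * B) - S) := by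
    have k : Commute (2 • (B * B) - S) (2 • (A * A) - P) := by
      have c1 : Commute B A := hAB.symm
      have c2 : Commute B P := h3.symm
      have c3 : Commute S A := h4
      have c4 : Commute S P := hPS.symm
      exact (((c1.mul_right c1).mul_left (c1.mul_right c1)).smul_right 2 |>.smul_left 2 |>.sub_right
        ((c2.mul_left c2).smul_left 2)).sub_left (((c3.mul_right c3).smul_right 2).sub_right c4)
    exact k.eq
  simp only [Uop, hA, hB, hP, hS]
  exact ⟨hUV, hcomm.trans hUV⟩

/-- L_c commutes with U_c, so U_c(c ∘ b) = c ∘ c = U_c(1), and U_c is injective. -/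
theorem isInverse_of_Uop {c b : M} {V : M →L[ℝ] M} (hV : V * Uop c = 1) (hb : Uop c b = c) :
    IsInverse c b := by
  have hinj : Function.Injective (Uop c) := fun x y hxy => by
    have := congrArg V hxy
    rwa [← mul_apply_eq_comp, ← mul_apply_eq_comp, hV] at this
  have hcomm : mulL c * Uop c = Uop c * mulL c := by
    have := (commute_mulL_sq c).eq
    simp only [Uop]
    linear_combination (norm := noncomm_ring) -this
  have h1 : c * b = 1 := hinj <| by
    have := congrArg (fun T : M →L[ℝ] M => T b) hcomm
    simp only [mul_apply_eq_comp, mulL_apply, hb] at this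
    rw [← this, Uop_apply_one]
  refine ⟨h1, ?_⟩
  rw [Uop_apply, U, h1, one_mul, two_smul] at hb
  linear_combination (norm := abel) -hb

end Inverse

/-! ### Exponentials of operators. -/

section OperatorExponential

variable {E : Type*} [NormedAddCommGroup E] [NormedSpace ℝ E] [CompleteSpace E]

theorem exp_smul_mul_exp_smul_neg (X : E →L[ℝ] E) (t : ℝ) :
    NormedSpace.exp (t • X) * NormedSpace.exp (t • -X) = 1 := by
  let _ : NormedAlgebra ℚ (E →L[ℝ] E) := NormedAlgebra.restrictScalars ℚ ℝ _
  rw [← NormedSpace.exp_add_of_commute (by rw [smul_neg]; exact (Commute.refl _).neg_right)]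
  simp

/-- Commutation allows factoring out e^{A(t)}, which moves the problem to the origin, where exp has
derivative the identity. -/
theorem hasDerivAt_exp_of_commute {A : ℝ → E →L[ℝ] E} {A' : E →L[ℝ] E} {t : ℝ}
    (hA : HasDerivAt A A' t) (hcomm : ∀ s, Commute (A s) (A t)) :
    HasDerivAt (fun s => NormedSpace.exp (A s)) (NormedSpace.exp (A t) * A') t := by
  let _ : NormedAlgebra ℚ (E →L[ℝ] E) := NormedAlgebra.restrictScalars ℚ ℝ _
  have h0 : HasFDerivAt (NormedSpace.exp : (E →L[ℝ] E) → E →L[ℝ] E)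
      (1 : (E →L[ℝ] E) →L[ℝ] (E →L[ℝ] E)) (A t - A t) := by
    rw [sub_self]
    exact hasFDerivAt_exp_zero
  have h1 := (h0.comp_hasDerivAt t (hA.sub_const (A t))).const_mul (NormedSpace.exp (A t))
  refine h1.congr_of_eventuallyEq (Filter.Eventually.of_forall fun s => ?_)
  change _ = NormedSpace.exp (A t) * NormedSpace.exp (A s - A t)
  rw [← NormedSpace.exp_add_of_commute ((hcomm s).symm.sub_right (Commute.refl _)), add_sub_cancel]

end OperatorExponential

/-! ### The Jordan exponential and its U-operator. -/

section Exponential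

variable {M : Type*} [NormedNonAssocCommRing M] [NormedSpace ℝ M] [IsScalarTower ℝ M M]
  [SMulCommClass ℝ M M]

theorem npow_eq (a : M) (n : ℕ) : npow a n = (mulL a ^ n) 1 := by
  induction n with
  | zero => rfl
  | succ n ih => rw [npow, ih, pow_succ', mul_apply_eq_comp, mulL_apply]

variable [CompleteSpace M]

theorem exp_mulL_apply_one (a : M) : NormedSpace.exp (mulL a) 1 = exp ℝ a := by
  have h := NormedSpace.exp_series_hasSum_exp' (𝕂 := ℝ) (mulL a)
  have h2 := (ContinuousLinearMap.apply ℝ M (1 : M)).hasSum h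
  exact (HasSum.tsum_eq (f := fun n : ℕ => ((n.factorial : ℝ)⁻¹) • npow a n)
    (by simpa [npow_eq] using h2)).symm

/-- The exponential `e^{L_a}` as an invertible operator. -/
noncomputable def expUnit (a : M) : (M →L[ℝ] M)ˣ where
  val := NormedSpace.exp (mulL a)
  inv := NormedSpace.exp (mulL (-a))
  val_inv := by simpa using exp_smul_mul_exp_smul_neg (mulL a) 1
  inv_val := by simpa using exp_smul_mul_exp_smul_neg (mulL (-a)) 1

theorem expUnit_inv (a : M) : (expUnit a)⁻¹ = expUnit (-a) :=
  Units.ext rfl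

variable [IsCommJordan M]

/-- With v(t) = e^{tL_a} b, the function e^{-tL_a} U_{v(t)} e^{-tL_a} has zero derivative by
`mulL_mul_Uop_add`; compare t = 1 with t = 0. -/
theorem Uop_exp_apply (a b : M) :
    Uop (NormedSpace.exp (mulL a) b) =
      NormedSpace.exp (mulL a) * Uop b * NormedSpace.exp (mulL a) := by
  have hd : ∀ t : ℝ, HasDerivAt (fun t : ℝ => NormedSpace.exp (t • -mulL a) *
      Uop (NormedSpace.exp (t • mulL a) b) * NormedSpace.exp (t • -mulL a)) 0 t := by
    intro t
    have hv : HasDerivAt (fun t : ℝ => NormedSpace.exp (t • mulL a) b)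
        (a * NormedSpace.exp (t • mulL a) b) t := by
      have := (ContinuousLinearMap.apply ℝ M b).hasFDerivAt.comp_hasDerivAt t
        (hasDerivAt_exp_smul_const' (mulL a) t)
      exact this
    generalize hw : (fun t : ℝ => NormedSpace.exp (t • mulL a) b) = v at hv
    have hwt : ∀ t : ℝ, NormedSpace.exp (t • mulL a) b = v t := fun t => congrFun hw t
    simp only [hwt] at hv ⊢
    have hL : HasDerivAt (fun t => mulL (v t)) (mulL (a * v t)) t :=
      (mulL (M := M)).hasFDerivAt.comp_hasDerivAt t hv
    have hsq : HasDerivAt (fun t => mulL (v t * v t)) (2 • mulL ((a * v t) * v t)) t := by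
      have := (mulL (M := M)).hasFDerivAt.comp_hasDerivAt t (hL.clm_apply hv)
      refine this.congr_deriv ?_
      rw [mulL_apply, mulL_apply, mul_comm (v t), ← two_smul ℕ, map_nsmul]
    have hU : HasDerivAt (fun t => Uop (v t))
        (mulL a * Uop (v t) + Uop (v t) * mulL a) t := by
      refine (((hL.mul hL).const_smul 2).sub hsq).congr_deriv ?_
      rw [mulL_mul_Uop_add]
    refine (((hasDerivAt_exp_smul_const (-mulL a) t).mul hU).mul
      (hasDerivAt_exp_smul_const' (-mulL a) t)).congr_deriv ?_
    simp only [Pi.mul_apply]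
    noncomm_ring
  have hc := is_const_of_deriv_eq_zero (fun t => (hd t).differentiableAt) (fun t => (hd t).deriv) 1 0
  simp only [one_smul, zero_smul, NormedSpace.exp_zero, one_mul, mul_one,
    one_apply_eq_self] at hc
  have h1 := exp_smul_mul_exp_smul_neg (mulL a) 1
  have h2 := exp_smul_mul_exp_smul_neg (-mulL a) 1
  simp only [one_smul, neg_neg] at h1 h2
  rw [← hc]
  calc _ = (NormedSpace.exp (mulL a) * NormedSpace.exp (-mulL a)) *
        Uop (NormedSpace.exp (mulL a) b) * (NormedSpace.exp (-mulL a) * NormedSpace.exp (mulL a)) := by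
        rw [h1, h2, one_mul, mul_one]
    _ = _ := by noncomm_ring

theorem Uop_exp (a : M) :
    Uop (exp ℝ a) = NormedSpace.exp (mulL a) * NormedSpace.exp (mulL a) := by
  rw [← exp_mulL_apply_one, Uop_exp_apply, Uop_one, mul_one]

theorem Uop_exp_half (a : M) : Uop (exp ℝ ((1 / 2 : ℝ) • a)) = NormedSpace.exp (mulL a) := by
  let _ : NormedAlgebra ℚ (M →L[ℝ] M) := NormedAlgebra.restrictScalars ℚ ℝ _
  rw [Uop_exp, ← NormedSpace.exp_add_of_commute (Commute.refl _), ← map_add, ← add_smul]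
  norm_num

end Exponential

/-! ### Logarithms near the unit. -/

section Logarithm

variable {M : Type*} [NormedNonAssocCommRing M] [NormedSpace ℝ M] [IsScalarTower ℝ M M]
  [SMulCommClass ℝ M M]

/-- The elements whose multiplication operator lies in the double commutant of `L_x`, `L_{x²}`. -/
noncomputable def bicommutant (x : M) : Submodule ℝ M :=
  (Subalgebra.toSubmodule (Subalgebra.centralizer ℝ
    (Set.centralizer {mulL x, mulL (x * x)}))).comap (mulL (M := M)).toLinearMap

theorem mem_bicommutant {x m : M} : m ∈ bicommutant x ↔
    mulL m ∈ Subalgebra.centralizer ℝ (Set.centralizer {mulL x, mulL (x * x)}) := Iff.rfl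

theorem isClosed_bicommutant (x : M) : IsClosed (bicommutant x : Set M) :=
  (Set.isClosed_centralizer _).preimage (mulL (M := M)).continuous

theorem tsum_mem_bicommutant {x : M} {f : ℕ → M} (hf : ∀ n, f n ∈ bicommutant x) :
    ∑' n, f n ∈ bicommutant x := by
  by_cases h : Summable f
  · exact (isClosed_bicommutant x).mem_of_tendsto h.hasSum
      (Filter.Eventually.of_forall fun s => Submodule.sum_mem _ fun n _ => hf n)
  · rw [tsum_eq_zero_of_not_summable h]
    exact zero_mem _

variable [IsCommJordan M]

theorem commute_of_mem_bicommutant {x m n : M} (hm : m ∈ bicommutant x) (hn : n ∈ bicommutant x) :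
    Commute (mulL m) (mulL n) := by
  have hS : ({mulL x, mulL (x * x)} : Set (M →L[ℝ] M)) ⊆
      Set.centralizer {mulL x, mulL (x * x)} := by
    have h := (commute_mulL_sq x).eq
    rintro p (rfl | rfl) q (rfl | rfl)
    · rfl
    · exact h.symm
    · exact h
    · rfl
  exact (hn (mulL m) (Set.centralizer_subset hS hm))

/-- By `mulL_mul_mul`, the operator of xⁿ⁺² is a polynomial in those of x, x², xⁿ and xⁿ⁺¹, hence
the induction on consecutive pairs. -/
theorem npow_mem_bicommutant (x : M) (n : ℕ) : npow x n ∈ bicommutant x := by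
  have hx : x ∈ bicommutant x := fun p hp => (hp (mulL x) (by simp)).symm
  have hxx : x * x ∈ bicommutant x := fun p hp => (hp (mulL (x * x)) (by simp)).symm
  suffices h : npow x n ∈ bicommutant x ∧ npow x (n + 1) ∈ bicommutant x from h.1
  induction n with
  | zero =>
    refine ⟨?_, by simpa [npow] using hx⟩
    rw [mem_bicommutant, npow, mulL_one]
    exact one_mem _
  | succ n ih =>
    refine ⟨ih.2, ?_⟩
    have e1 : npow x (n + 1 + 1) = (x * npow x n) * x := mul_comm _ _
    have e2 : npow x n * x = npow x (n + 1) := mul_comm _ _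
    rw [mem_bicommutant, e1, mulL_mul_mul, e2]
    obtain ⟨h1, h2⟩ := ih
    rw [mem_bicommutant] at *
    exact sub_mem (sub_mem (add_mem (add_mem (mul_mem hx h2) (mul_mem hx h2)) (mul_mem h1 hxx))
      (mul_mem (mul_mem hx hx) h1)) (mul_mem (mul_mem h1 hx) hx)

variable [CompleteSpace M]

/-- If the powers of `x` decay geometrically, then `1 - x` is an exponential. -/
theorem exists_exp_eq_one_sub {x : M} {C : ℝ} (hx : ∀ n, ‖npow x n‖ ≤ C * (1 / 2) ^ n) :
    ∃ l : M, NormedSpace.exp (mulL l) 1 = 1 - x := by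
  have hC : 0 ≤ C := by simpa using (norm_nonneg _).trans (hx 0)
  -- An open interval containing [0, 1] on which the series still converge, with ratio 3/2 · 1/2 =
  -- 3/4.
  set I : Set ℝ := Set.Ioo (-(3 / 2)) (3 / 2) with hI
  have h0I : (0 : ℝ) ∈ I := by norm_num [hI]
  have h1I : (1 : ℝ) ∈ I := by norm_num [hI]
  -- y(t) is the series of log(1 - tx) and z(t) its derivative. All L_{y(t)} commute, so
  -- e^{-L_{y(t)}}(1 - tx) can be differentiated and is constant.
  set y : ℝ → M := fun t => ∑' n : ℕ, (-(t ^ (n + 1) / (n + 1))) • npow x (n + 1) with hy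
  set z : ℝ → M := fun t => ∑' n : ℕ, (-(t ^ n)) • npow x (n + 1) with hz
  have hbound : ∀ n : ℕ, ∀ t ∈ I, ‖(-(t ^ n)) • npow x (n + 1)‖ ≤ C * (3 / 4) ^ n := by
    intro n t ht
    have ht' : |t| ≤ 3 / 2 := abs_le.2 ⟨ht.1.le, ht.2.le⟩
    rw [norm_smul, norm_neg, norm_pow, Real.norm_eq_abs]
    calc |t| ^ n * ‖npow x (n + 1)‖ ≤ (3 / 2) ^ n * (C * (1 / 2) ^ (n + 1)) := by
          gcongr; exact hx _
      _ = C * (3 / 4) ^ n * (1 / 2) := by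
          rw [pow_succ, show (3 / 4 : ℝ) = 3 / 2 * (1 / 2) by norm_num, mul_pow]; ring
      _ ≤ C * (3 / 4) ^ n := by
          have : 0 ≤ C * (3 / 4 : ℝ) ^ n := by positivity
          linarith
  have hsum : Summable fun n : ℕ => C * (3 / 4 : ℝ) ^ n :=
    (summable_geometric_of_lt_one (by norm_num) (by norm_num)).mul_left C
  have hyd : ∀ t ∈ I, HasDerivAt y (z t) t := by
    intro t ht
    refine hasDerivAt_tsum_of_isPreconnected hsum isOpen_Ioo isPreconnected_Ioo
      (fun n s _ => ?_) hbound h0I ?_ ht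
    · have h := ((hasDerivAt_pow (n + 1) s).div_const ((n : ℝ) + 1)).neg.smul_const
        (npow x (n + 1))
      refine h.congr_deriv ?_
      congr 2
      have : (n : ℝ) + 1 ≠ 0 := by positivity
      push_cast
      field_simp
    · simp
  have hzx : ∀ t ∈ I, z t * (1 - t • x) = -x := by
    intro t ht
    have hs : Summable fun n : ℕ => (-(t ^ n)) • npow x (n + 1) :=
      Summable.of_norm_bounded hsum fun n => hbound n t ht
    have h1 : t • (x * z t) = ∑' n : ℕ, (-(t ^ (n + 1))) • npow x (n + 1 + 1) := by
      have := (t • mulL x).map_tsum hs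
      simp only [smul_apply, mulL_apply] at this
      rw [hz, this]
      refine tsum_congr fun n => ?_
      rw [mul_smul_comm, smul_smul, npow, pow_succ']
      congr 1
      ring
    have h2 : z t = -x + t • (x * z t) := by
      rw [h1]
      have := hs.tsum_eq_zero_add
      simpa [npow, hz] using this
    rw [mul_sub, mul_one, mul_smul_comm, mul_comm (z t) x, sub_eq_iff_eq_add]
    exact h2
  have hym : ∀ t, y t ∈ bicommutant x := fun t =>
    tsum_mem_bicommutant fun n => Submodule.smul_mem _ _ (npow_mem_bicommutant x _)
  have hG : ∀ t ∈ I, HasDerivAt (fun t => NormedSpace.exp (-mulL (y t)) (1 - t • x)) 0 t := by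
    intro t ht
    have hA : HasDerivAt (fun t => -mulL (y t)) (-mulL (z t)) t :=
      ((mulL (M := M)).hasFDerivAt.comp_hasDerivAt t (hyd t ht)).neg
    have hE := hasDerivAt_exp_of_commute hA fun s =>
      ((commute_of_mem_bicommutant (hym s) (hym t)).neg_left).neg_right
    have hl : HasDerivAt (fun t : ℝ => (1 : M) - t • x) (-x) t := by
      simpa using ((hasDerivAt_id t).smul_const x).const_sub (1 : M)
    refine (hE.clm_apply hl).congr_deriv ?_
    rw [mul_apply_eq_comp, neg_apply, mulL_apply, hzx t ht, neg_neg,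
      ← map_add, add_neg_cancel, map_zero]
  have hconst := isOpen_Ioo.is_const_of_deriv_eq_zero isPreconnected_Ioo
    (fun t ht => (hG t ht).differentiableAt.differentiableWithinAt)
    (fun t ht => (hG t ht).deriv) h1I h0I
  have hy0 : y 0 = 0 := by simp [hy]
  simp only [hy0, map_zero, neg_zero, NormedSpace.exp_zero, one_smul, zero_smul, sub_zero,
    one_apply_eq_self] at hconst
  refine ⟨y 1, ?_⟩
  have h2 := exp_smul_mul_exp_smul_neg (mulL (y 1)) 1
  simp only [one_smul] at h2
  conv_lhs => rw [← hconst, ← mul_apply_eq_comp, h2, one_apply_eq_self]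

end Logarithm

/-! ### Operators acting on U-operators by congruence. -/

section Congruence

variable {M : Type*} [NormedNonAssocCommRing M] [NormedSpace ℝ M] [IsScalarTower ℝ M M]
  [SMulCommClass ℝ M M]

/-- Polarisation of U_{gc}(h⁻¹1) = g(c²): g carries the product of M to a triple product with fixed
middle entry h⁻¹1. -/
theorem apply_mul_eq_Utri {g h : (M →L[ℝ] M)ˣ}
    (e : ∀ b : M, Uop ((g : M →L[ℝ] M) b) = g * Uop b * h) (a b : M) :
    (g : M →L[ℝ] M) (a * b) =
      Utri ((g : M →L[ℝ] M) a) ((↑h⁻¹ : M →L[ℝ] M) 1) ((g : M →L[ℝ] M) b) := by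
  have hsq : ∀ c : M, Uop ((g : M →L[ℝ] M) c) ((↑h⁻¹ : M →L[ℝ] M) 1) = (g : M →L[ℝ] M) (c * c) := by
    intro c
    rw [e, ← mul_apply_eq_comp, mul_assoc, Units.mul_inv, mul_one, mul_apply_eq_comp, Uop_apply_one]
  have h1 := hsq (a + b)
  rw [map_add, Uop_add_apply, hsq, hsq] at h1
  have h2 : (a + b) * (a + b) = a * a + b * b + 2 • (a * b) := by
    rw [add_mul, mul_add, mul_add, mul_comm b a, two_smul]
    abel
  rw [h2, map_add, map_add, map_nsmul, add_right_inj, ← Nat.cast_smul_eq_nsmul ℝ,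
    ← Nat.cast_smul_eq_nsmul ℝ] at h1
  exact (smul_right_injective M (two_ne_zero' ℝ) (by simpa using h1)).symm

variable [IsCommJordan M]

/-- If `g` acts on `U`-operators by congruence, then `g 1` is invertible. -/
theorem exists_isInverse_apply_one {g h : (M →L[ℝ] M)ˣ}
    (e : ∀ b : M, Uop ((g : M →L[ℝ] M) b) = g * Uop b * h) :
    IsInverse ((g : M →L[ℝ] M) 1) ((↑h⁻¹ : M →L[ℝ] M) 1) := by
  have e1 : Uop ((g : M →L[ℝ] M) 1) = ↑(g * h) := by rw [e, Uop_one, mul_one, Units.val_mul]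
  refine isInverse_of_Uop (V := ↑(g * h)⁻¹) (by rw [e1, Units.inv_mul]) ?_
  rw [e1, ← mul_apply_eq_comp, ← Units.val_mul, mul_inv_cancel_right]

theorem IsInverse.unique {a b c : M} (hb : IsInverse a b) (hc : IsInverse a c) : b = c := by
  have e := hb.Uop_mul_Uop.2
  have := congrArg (Uop b) (hb.Uop_apply.trans hc.Uop_apply.symm)
  rwa [← mul_apply_eq_comp, ← mul_apply_eq_comp, e] at this

theorem npow_add_two (a : M) (n : ℕ) : npow a (n + 2) = U a (npow a n) := by
  have h : Commute (mulL (a * a)) (mulL a ^ n) := (commute_mulL_sq a).symm.pow_right n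
  have e : (a * a) * npow a n = npow a (n + 2) := by
    have h1 := congrArg (fun T : M →L[ℝ] M => T 1) h.eq
    simp only [mul_apply_eq_comp, mulL_apply, mul_one] at h1
    rw [npow_eq, h1, npow_eq, pow_add, mul_apply_eq_comp, pow_two, mul_apply_eq_comp]
    simp
  rw [U, e, two_smul, mul_comm (a * npow a n) a]
  exact (add_sub_cancel_right _ _).symm

end Congruence

/-! ### The orbit of the unit and the principal component. -/

section ExponentialOrbit

variable {M : Type*} [NormedNonAssocCommRing M] [NormedSpace ℝ M] [IsScalarTower ℝ M M]
  [SMulCommClass ℝ M M] [CompleteSpace M]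

variable (M) in
/-- The group of operators generated by the exponentials `e^{L_a}`. -/
noncomputable def expGroup : Submonoid (M →L[ℝ] M)ˣ :=
  Submonoid.closure (Set.range expUnit)

theorem expUnit_mem (a : M) : expUnit a ∈ expGroup M := Submonoid.subset_closure ⟨a, rfl⟩

theorem inv_mem_expGroup {g : (M →L[ℝ] M)ˣ} (hg : g ∈ expGroup M) : g⁻¹ ∈ expGroup M := by
  induction hg using Submonoid.closure_induction with
  | mem g hg =>
    obtain ⟨a, rfl⟩ := hg
    exact expUnit_inv a ▸ expUnit_mem (-a)
  | one => simp
  | mul g h _ _ hg hh => simpa using mul_mem hh hg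

variable (M) in
/-- The orbit of `1` under the group generated by the exponentials `e^{L_a}`. -/
def expOrbit : Set M := {c | ∃ g ∈ expGroup M, (g : M →L[ℝ] M) 1 = c}

theorem one_mem_expOrbit : (1 : M) ∈ expOrbit M := ⟨1, one_mem _, rfl⟩

theorem apply_mem_expOrbit {g : (M →L[ℝ] M)ˣ} (hg : g ∈ expGroup M) {c : M}
    (hc : c ∈ expOrbit M) : (g : M →L[ℝ] M) c ∈ expOrbit M := by
  obtain ⟨h, hh, rfl⟩ := hc
  exact ⟨g * h, mul_mem hg hh, rfl⟩

theorem exp_mem_expOrbit (a : M) : exp ℝ a ∈ expOrbit M :=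
  ⟨expUnit a, expUnit_mem a, exp_mulL_apply_one a⟩

variable [IsCommJordan M]

/-- Elements of the group act on `U`-operators by congruence. -/
theorem exists_Uop_apply_eq {g : (M →L[ℝ] M)ˣ} (hg : g ∈ expGroup M) :
    ∃ h ∈ expGroup M, ∀ b : M, Uop ((g : M →L[ℝ] M) b) = g * Uop b * h := by
  induction hg using Submonoid.closure_induction with
  | mem g hg =>
    obtain ⟨a, rfl⟩ := hg
    exact ⟨_, expUnit_mem a, Uop_exp_apply a⟩
  | one => exact ⟨1, one_mem _, fun b => by simp⟩
  | mul g₁ g₂ _ _ h₁ h₂ =>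
    obtain ⟨k₁, hk₁, e₁⟩ := h₁
    obtain ⟨k₂, hk₂, e₂⟩ := h₂
    -- The partner of a product is the product of the partners in reverse order.
    refine ⟨k₂ * k₁, mul_mem hk₂ hk₁, fun b => ?_⟩
    rw [Units.val_mul, mul_apply_eq_comp, e₁, e₂, Units.val_mul]
    simp only [mul_assoc]

theorem isQuadraticSubset_expOrbit : IsQuadraticSubset (expOrbit M) := by
  constructor
  · rintro _ ⟨g, hg, rfl⟩
    obtain ⟨h, -, e⟩ := exists_Uop_apply_eq hg
    exact ⟨_, exists_isInverse_apply_one e⟩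
  · rintro _ ⟨g, hg, rfl⟩ b hb
    obtain ⟨h, hh, e⟩ := exists_Uop_apply_eq hg
    rw [← Uop_apply, e, Uop_one, mul_one, ← Units.val_mul]
    exact apply_mem_expOrbit (mul_mem hg hh) hb

theorem inverse_mem_expOrbit {a : M} (ha : a ∈ expOrbit M) : inverse a ∈ expOrbit M := by
  have hi := inverse_spec (isQuadraticSubset_expOrbit.1 ha)
  obtain ⟨g, hg, rfl⟩ := ha
  obtain ⟨h, hh, e⟩ := exists_Uop_apply_eq hg
  rw [hi.unique (exists_isInverse_apply_one e)]
  exact ⟨h⁻¹, inv_mem_expGroup hh, rfl⟩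

theorem npow_mem_expOrbit {a : M} (ha : a ∈ expOrbit M) (n : ℕ) : npow a n ∈ expOrbit M := by
  suffices h : npow a n ∈ expOrbit M ∧ npow a (n + 1) ∈ expOrbit M from h.1
  induction n with
  | zero => exact ⟨one_mem_expOrbit, by simpa [npow] using ha⟩
  | succ n ih => exact ⟨ih.2, npow_add_two a n ▸ isQuadraticSubset_expOrbit.2 _ ha _ ih.1⟩

theorem zpow_mem_expOrbit {a : M} (ha : a ∈ expOrbit M) : ∀ n : ℤ, zpow a n ∈ expOrbit M
  | Int.ofNat n => npow_mem_expOrbit ha n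
  | Int.negSucc n => npow_mem_expOrbit (inverse_mem_expOrbit ha) (n + 1)

theorem expOrbit_subset {S : Set M} (hS : IsQuadraticSubset S)
    (hexp : Set.range (exp ℝ : M → M) ⊆ S) : expOrbit M ⊆ S := by
  rintro _ ⟨g, hg, rfl⟩
  have h1 : (1 : M) ∈ S := by
    have := hexp ⟨0, rfl⟩
    rwa [← exp_mulL_apply_one, map_zero, NormedSpace.exp_zero, one_apply_eq_self] at this
  suffices h : ∀ s ∈ S, (g : M →L[ℝ] M) s ∈ S from h 1 h1
  induction hg using Submonoid.closure_induction with
  | mem g hg =>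
    obtain ⟨a, rfl⟩ := hg
    intro s hs
    change NormedSpace.exp (mulL a) s ∈ S
    rw [← Uop_exp_half, Uop_apply]
    exact hS.2 _ (hexp ⟨_, rfl⟩) _ hs
  | one => exact fun s hs => hs
  | mul g h _ _ hg hh => exact fun s hs => hg _ (hh _ hs)

theorem expOrbit_subset_principalComponent : expOrbit M ⊆ principalComponent M := by
  rintro _ ⟨g, hg, rfl⟩
  suffices h : ∀ s ∈ expOrbit M, s ∈ principalComponent M →
      (g : M →L[ℝ] M) s ∈ principalComponent M from
    h 1 one_mem_expOrbit (mem_connectedComponentIn one_mem_invertibles)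
  induction hg using Submonoid.closure_induction with
  | mem g hg =>
    obtain ⟨a, rfl⟩ := hg
    intro s hs hsp
    have hcont : Continuous fun t : ℝ => NormedSpace.exp (mulL (t • a)) s := by
      have : Differentiable ℝ fun t : ℝ => NormedSpace.exp (t • mulL a) := fun t =>
        (hasDerivAt_exp_smul_const (mulL a) t).differentiableAt
      simp only [map_smul]
      exact this.continuous.clm_apply continuous_const
    have hsub : Set.range (fun t : ℝ => NormedSpace.exp (mulL (t • a)) s) ⊆ invertibles M := by
      rintro _ ⟨t, rfl⟩
      exact isQuadraticSubset_expOrbit.1 (apply_mem_expOrbit (expUnit_mem (t • a)) hs)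
    have h := (isPreconnected_range hcont).subset_connectedComponentIn (x := s) ⟨0, by simp⟩ hsub
    rw [principalComponent, connectedComponentIn_eq (F := invertibles M) hsp]
    exact h ⟨1, by simp [expUnit]⟩
  | one => exact fun s _ hs => hs
  | mul g h hg' hh' hg hh => exact fun s hs hsp => hg _ (apply_mem_expOrbit hh' hs) (hh _ hs hsp)

/-- Quantitative form of the openness of the orbit. -/
theorem mem_expOrbit_of_norm_le {p q d : M} (hp : p ∈ expOrbit M) (hd : IsInverse p d)
    (hq : 3 * ‖d‖ * ‖p - q‖ ≤ 1 / 2) : q ∈ expOrbit M := by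
  obtain ⟨g, hg, rfl⟩ := hp
  obtain ⟨h, -, e⟩ := exists_Uop_apply_eq hg
  obtain rfl := hd.unique (exists_isInverse_apply_one e)
  set x : M := (↑g⁻¹ : M →L[ℝ] M) ((g : M →L[ℝ] M) 1 - q) with hx
  have hgi : ∀ v : M, (↑g⁻¹ : M →L[ℝ] M) ((g : M →L[ℝ] M) v) = v := fun v => by
    rw [← mul_apply_eq_comp, Units.inv_mul, one_apply_eq_self]
  have hgx : (g : M →L[ℝ] M) x = (g : M →L[ℝ] M) 1 - q := by
    rw [hx, ← mul_apply_eq_comp, Units.mul_inv, one_apply_eq_self]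
  -- Estimating g(xⁿ) by the triple product costs a factor 3‖d‖‖p - q‖ ≤ 1/2 per power, free of the
  -- norms of g and g⁻¹.
  have hpow : ∀ n, ‖(g : M →L[ℝ] M) (npow x n)‖ ≤ ‖(g : M →L[ℝ] M) 1‖ * (1 / 2) ^ n := by
    intro n
    induction n with
    | zero => simp [npow]
    | succ n ih =>
      rw [npow, apply_mul_eq_Utri e, hgx]
      calc _ ≤ 3 * ‖(g : M →L[ℝ] M) 1 - q‖ * ‖(↑h⁻¹ : M →L[ℝ] M) 1‖ *
            ‖(g : M →L[ℝ] M) (npow x n)‖ := norm_Utri_le _ _ _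
        _ = 3 * ‖(↑h⁻¹ : M →L[ℝ] M) 1‖ * ‖(g : M →L[ℝ] M) 1 - q‖ *
            ‖(g : M →L[ℝ] M) (npow x n)‖ := by ring
        _ ≤ 1 / 2 * (‖(g : M →L[ℝ] M) 1‖ * (1 / 2) ^ n) := by gcongr
        _ = _ := by ring
  -- ‖g⁻¹‖ enters only the constant C, not the decay rate. Then q = g(1 - x) = g e^{L_l} 1.
  obtain ⟨l, hl⟩ := exists_exp_eq_one_sub (x := x)
    (C := ‖(↑g⁻¹ : M →L[ℝ] M)‖ * ‖(g : M →L[ℝ] M) 1‖) fun n => by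
      calc ‖npow x n‖ = ‖(↑g⁻¹ : M →L[ℝ] M) ((g : M →L[ℝ] M) (npow x n))‖ := by rw [hgi]
        _ ≤ ‖(↑g⁻¹ : M →L[ℝ] M)‖ * ‖(g : M →L[ℝ] M) (npow x n)‖ :=
          ContinuousLinearMap.le_opNorm _ _
        _ ≤ ‖(↑g⁻¹ : M →L[ℝ] M)‖ * (‖(g : M →L[ℝ] M) 1‖ * (1 / 2) ^ n) := by
          gcongr; exact hpow n
        _ = _ := by ring
  refine ⟨g * expUnit l, mul_mem hg (expUnit_mem l), ?_⟩
  change (g : M →L[ℝ] M) (NormedSpace.exp (mulL l) 1) = q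
  rw [hl, map_sub, hgx, sub_sub_cancel]

open Filter Topology in
/-- Membership in the orbit is locally constant on the set of invertible elements. -/
theorem eventually_mem_expOrbit_iff {c : M} (hc : c ∈ invertibles M) :
    ∀ᶠ q in 𝓝 c, c ∈ expOrbit M ↔ q ∈ expOrbit M := by
  obtain ⟨b, hb⟩ := hc
  obtain ⟨e1, e2⟩ := hb.Uop_mul_Uop
  have hinv : ∀ q d : M, IsInverse q d → Ring.inverse (Uop q) q = d := by
    intro q d hd
    obtain ⟨k1, k2⟩ := hd.Uop_mul_Uop
    have : Ring.inverse (Uop q) = Uop d := Ring.inverse_unit ⟨Uop q, Uop d, k1, k2⟩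
    rw [this]
    conv_lhs => rw [← hd.Uop_apply]
    rw [← mul_apply_eq_comp, k2, one_apply_eq_self]
  have hcont : ContinuousAt (fun q : M => Ring.inverse (Uop q)) c := by
    have := NormedRing.inverse_continuousAt (⟨Uop c, Uop b, e1, e2⟩ : (M →L[ℝ] M)ˣ)
    exact ContinuousAt.comp (f := Uop) this continuous_Uop.continuousAt
  have h1 : ∀ᶠ q in 𝓝 c, 3 * ‖b‖ * ‖c - q‖ < 1 / 2 := by
    have : ContinuousAt (fun q : M => 3 * ‖b‖ * ‖c - q‖) c := by fun_prop
    exact this.eventually_lt_const (by simp)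
  -- For the converse the ball is centred at q; its radius is controlled because q⁻¹ = U_q⁻¹ q
  -- depends continuously on q at c.
  have h2 : ∀ᶠ q in 𝓝 c, 3 * ‖Ring.inverse (Uop q) q‖ * ‖q - c‖ < 1 / 2 := by
    have : ContinuousAt (fun q : M => 3 * ‖Ring.inverse (Uop q) q‖ * ‖q - c‖) c :=
      (continuousAt_const.mul (hcont.clm_apply continuousAt_id).norm).mul (by fun_prop)
    exact this.eventually_lt_const (by simp)
  filter_upwards [h1, h2] with q hq1 hq2
  refine ⟨fun h => mem_expOrbit_of_norm_le h hb hq1.le, fun h => ?_⟩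
  obtain ⟨d, hd⟩ := isQuadraticSubset_expOrbit.1 h
  rw [hinv q d hd] at hq2
  exact mem_expOrbit_of_norm_le h hd hq2.le

theorem principalComponent_eq_expOrbit : principalComponent M = expOrbit M := by
  refine Set.Subset.antisymm (fun c hc => ?_) expOrbit_subset_principalComponent
  have hpre : IsPreconnected (principalComponent M) := isPreconnected_connectedComponentIn
  refine hpre.induction₂' (fun p q => p ∈ expOrbit M → q ∈ expOrbit M) (fun p hp => ?_)
    (fun _ _ _ _ _ _ h h' hm => h' (h hm)) (mem_connectedComponentIn one_mem_invertibles) hc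
    one_mem_expOrbit
  filter_upwards [nhdsWithin_le_nhds
    (eventually_mem_expOrbit_iff (connectedComponentIn_subset _ _ hp))] with q hq
  exact ⟨hq.1, hq.2⟩

end ExponentialOrbit
end JordanBanach
theorem lemma2p5 (𝕜 M : Type*) [RCLike 𝕜] [NormedNonAssocCommRing M] [NormedSpace 𝕜 M]
    [UnitalJordanBanachAlgebra 𝕜 M] :
    IsLeast {S : Set M | JordanBanach.IsQuadraticSubset S ∧
        Set.range (JordanBanach.exp 𝕜 : M → M) ⊆ S}
      (JordanBanach.principalComponent M) ∧
    ∀ a ∈ JordanBanach.principalComponent M, ∀ n : ℤ,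
      JordanBanach.zpow a n ∈ JordanBanach.principalComponent M := by
  -- Real scalars suffice: the exponential has the same coefficients over ℝ and 𝕜, and the other
  -- notions do not involve scalars.
  let _ : NormedSpace ℝ M := NormedSpace.restrictScalars ℝ 𝕜 M
  have hsmul : ∀ (r : ℝ) (x : M), r • x = (r : 𝕜) • x := fun _ _ => rfl
  have _ : IsCommJordan M := UnitalJordanBanachAlgebra.toIsCommJordan 𝕜
  have _ : CompleteSpace M := UnitalJordanBanachAlgebra.toCompleteSpace 𝕜
  have _ : IsScalarTower 𝕜 M M := UnitalJordanBanachAlgebra.toIsScalarTower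
  have _ : SMulCommClass 𝕜 M M := UnitalJordanBanachAlgebra.toSMulCommClass
  have _ : IsScalarTower ℝ M M := ⟨fun r x y => by
    simp only [hsmul, smul_eq_mul, smul_mul_assoc]⟩
  have _ : SMulCommClass ℝ M M := ⟨fun r x y => by
    simp only [hsmul, smul_eq_mul, mul_smul_comm]⟩
  have hexp : (JordanBanach.exp 𝕜 : M → M) = JordanBanach.exp ℝ := by
    funext a
    refine tsum_congr fun n => ?_
    rw [hsmul]
    simp
  rw [hexp, JordanBanach.principalComponent_eq_expOrbit]
  refine ⟨⟨⟨JordanBanach.isQuadraticSubset_expOrbit, ?_⟩, ?_⟩, ?_⟩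
  · rintro _ ⟨a, rfl⟩
    exact JordanBanach.exp_mem_expOrbit a
  · exact fun S hS => JordanBanach.expOrbit_subset hS.1 hS.2
  · exact fun a ha n => JordanBanach.zpow_mem_expOrbit ha n
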